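/- \textbf{Theorem.} $\Lambda$-terms are given by the grammar $t ::= x \mid t\,t \mid \lambda x.t \mid t[x/t]$ and are considered up to $\alpha$-conversion, where $\lambda x.t$ and $t[x/u]$ bind $x$ in $t$ (but $t[x/u]$ does not bind $x$ in $u$). The $\lambda_{sub}$-reduction relation on $\Lambda$-terms is the closure under all contexts of the rules \[ \begin{array}{lcll} (\lambda x.t)\,u & \to_{\tt B} & t[x/u], & \\ t[x/u] & \to_{\tt Gc} & t & \text{if } x \notin \mathrm{fv}(t),\\ C[\![x]\!][x/u] & \to_{\tt R} & C[\![u]\!][x/u], & \end{array} \] where in the last rule $C$ is a context with one hole, and the hole is filled without capture of $x$ or of any free variable of $u$. A term is $\lambda_{sub}$-strongly normalising if no infinite $\lambda_{sub}$-reduction sequence starts at it. Types are built from a non-empty countable set of base types by the constructors $\to$ and $\cap$; an environment is a partial function from variables to types. The \emph{additive} intersection type system is given by the rules: $\Gamma, x{:}A \vdash x : A$; from $\Gamma \vdash t : A \to B$ and $\Gamma \vdash u : A$ infer $\Gamma \vdash t\,u : B$; from $\Gamma, x{:}A \vdash t : B$ infer $\Gamma \vdash \lambda x.t : A \to B$;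 from $\Gamma \vdash u : B$ and $\Gamma, x{:}B \vdash t : A$ infer $\Gamma \vdash t[x/u] : A$; from $\Gamma \vdash t : A$ and $\Gamma \vdash t : B$ infer $\Gamma \vdash t : A \cap B$; from $\Gamma \vdash t : A_1 \cap A_2$ infer $\Gamma \vdash t : A_i$ ($i = 1, 2$). The \emph{multiplicative} intersection type system is given by the same two rules for $\cap$ and the rules: $x{:}A \vdash x : A$; from $\Gamma \vdash t : A \to B$ and $\Delta \vdash u : A$ infer $\Gamma \uplus \Delta \vdash t\,u : B$; from $\Gamma, x{:}A \vdash t : B$, or from $\Gamma \vdash t : B$ with $x \notin \mathrm{dom}(\Gamma)$, infer $\Gamma \vdash \lambda x.t : A \to B$; from $\Gamma \vdash u : B$ and either $\Delta, x{:}B \vdash t : A$, or $\Delta \vdash t : A$ with $x \notin \mathrm{dom}(\Delta)$, infer $\Gamma \uplus \Delta \vdash t[x/u] : A$. Here $\Gamma \uplus \Delta$ is the union of the environments $\Gamma$ and $\Delta$, which have to agree on the common part of their domains. Let $t$ be a $\Lambda$-term. If $t$ is $\lambda_{sub}$-strongly normalising, then $t$ is intersection-typable: there are an environment $\Gamma$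 and a type $A$ such that $\Gamma \vdash t : A$ is derivable in the additive system, and there are an environment and a type for which the same holds in the multiplicative system. -/

import Mathlib

namespace LambdaSub

/-! ## Terms up to renaming of bound variables -/

/-- `Λ`-terms `t ::= x | t t | λx.t | t[x/t]`, taken up to `α`-conversion: variables are de Bruijn
indices, `lam t` binds the index `0` of `t`, and the closure `clos t u`, which stands for `t[x/u]`,
binds the index `0` of `t` and no index of `u`. -/
inductive Term : Type
  | var (x : ℕ) : Term
  | app (t u : Term) : Term
  | lam (t : Term) : Term
  | clos (t u : Term) : Term

/-- The renaming that acts as `ξ` below one more binder. -/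
def liftRen (ξ : ℕ → ℕ) : ℕ → ℕ
  | 0 => 0
  | n + 1 => ξ n + 1

/-- Capture-avoiding renaming of the free variables of a term. -/
def Term.rename : (ℕ → ℕ) → Term → Term
  | ξ, .var x => .var (ξ x)
  | ξ, .app t u => .app (t.rename ξ) (u.rename ξ)
  | ξ, .lam t => .lam (t.rename (liftRen ξ))
  | ξ, .clos t u => .clos (t.rename (liftRen ξ)) (u.rename ξ)

/-- The term `t` seen below `d` further binders, none of which binds a variable of `t`. -/
def Term.shift (d : ℕ) (t : Term) : Term := t.rename (fun x => x + d)

/-- `Λ`-contexts `C ::= □ | C t | t C | λx.C | C[x/t] | t[x/C]`. -/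
inductive Ctx : Type
  | hole : Ctx
  | appL (C : Ctx) (t : Term) : Ctx
  | appR (t : Term) (C : Ctx) : Ctx
  | lam (C : Ctx) : Ctx
  | closL (C : Ctx) (t : Term) : Ctx
  | closR (t : Term) (C : Ctx) : Ctx

/-- Plain replacement of the hole by a term; the indices of the term refer to the place of the
hole, so the binders of the context above the hole can bind variables of the term. -/
def Ctx.fill : Ctx → Term → Term
  | .hole, s => s
  | .appL C t, s => .app (C.fill s) t
  | .appR t C, s => .app t (C.fill s)
  | .lam C, s => .lam (C.fill s)
  | .closL C t, s => .clos (C.fill s) t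
  | .closR t C, s => .clos t (C.fill s)

/-- The number of binders of the context above its hole. -/
def Ctx.depth : Ctx → ℕ
  | .hole => 0
  | .appL C _ => C.depth
  | .appR _ C => C.depth
  | .lam C => C.depth + 1
  | .closL C _ => C.depth + 1
  | .closR _ C => C.depth

/-- Replacement of the hole by a term without capture of any variable of the term. -/
def Ctx.fillNoCapture (C : Ctx) (s : Term) : Term := C.fill (s.shift C.depth)

/-! ## Reduction -/

/-- The reduction rules `B`, `Gc` and `R` at the root of a term. -/
inductive Rule : Term → Term → Prop
  /-- `(λx.t) u → t[x/u]`. -/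
  | B (t u : Term) : Rule (.app (.lam t) u) (.clos t u)
  /-- `t[x/u] → t` if `x` is not free in `t`, that is, if the body of the closure is a term `t` of
  the surrounding scope, seen below one more binder. -/
  | Gc (t u : Term) : Rule (.clos (t.shift 1) u) t
  /-- `C⟦x⟧[x/u] → C⟦u⟧[x/u]`, where `C` captures neither `x` nor a free variable of `u`, and the
  copy of `u` is placed below the binder of the closure. -/
  | R (C : Ctx) (u : Term) :
      Rule (.clos (C.fillNoCapture (.var 0)) u) (.clos (C.fillNoCapture (u.shift 1)) u)

/-- The reduction relation of the `λ_sub`-calculus: the closure of the rules by all contexts. -/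
inductive Red : Term → Term → Prop
  | ctx (C : Ctx) {s s' : Term} (h : Rule s s') : Red (C.fill s) (C.fill s')

/-- `t` is `λ_sub`-strongly normalising: no infinite reduction sequence starts at `t`. -/
def SN (t : Term) : Prop :=
  ¬ ∃ f : ℕ → Term, f 0 = t ∧ ∀ n, Red (f n) (f (n + 1))

/-! ## Intersection types -/

/-- Types built over the base types in `Atom` with `→` and `∩`. -/
inductive Ty (Atom : Type*) : Type _
  | base (a : Atom) : Ty Atom
  | arrow (A B : Ty Atom) : Ty Atom
  | inter (A B : Ty Atom) : Ty Atom

/-- Environments: partial functions from variables to types. -/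
abbrev Env (Atom : Type*) : Type _ := ℕ → Option (Ty Atom)

namespace Env

variable {Atom : Type*}

/-- The environment below one more binder: `Γ.cons (some A)` is `Γ, x : A`, and `Γ.cons none` is
`Γ` itself, with the bound variable `x` not in the domain. -/
def cons (Γ : Env Atom) (o : Option (Ty Atom)) : Env Atom
  | 0 => o
  | n + 1 => Γ n

/-- The environment `x : A`. -/
def single (x : ℕ) (A : Ty Atom) : Env Atom := fun y => if y = x then some A else none

/-- Two environments are compatible if they agree on the intersection of their domains. -/
def Compatible (Γ Δ : Env Atom) : Prop :=
  ∀ x A B, Γ x = some A → Δ x = some B → A = B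

/-- The union `Γ ⊎ Δ` of environments (used for compatible ones only). -/
def union (Γ Δ : Env Atom) : Env Atom := fun x => (Γ x).or (Δ x)

end Env

/-- Derivability `Γ ⊢ t : A` in the additive intersection type system for `Λ`-terms. -/
inductive AddTyping {Atom : Type*} : Env Atom → Term → Ty Atom → Prop
  | ax {Γ : Env Atom} {x : ℕ} {A : Ty Atom} (h : Γ x = some A) : AddTyping Γ (.var x) A
  | app {Γ : Env Atom} {t u : Term} {A B : Ty Atom}
      (ht : AddTyping Γ t (.arrow A B)) (hu : AddTyping Γ u A) : AddTyping Γ (.app t u) B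
  | abs {Γ : Env Atom} {t : Term} {A B : Ty Atom}
      (ht : AddTyping (Γ.cons (some A)) t B) : AddTyping Γ (.lam t) (.arrow A B)
  | subs {Γ : Env Atom} {t u : Term} {A B : Ty Atom}
      (hu : AddTyping Γ u B) (ht : AddTyping (Γ.cons (some B)) t A) : AddTyping Γ (.clos t u) A
  | interI {Γ : Env Atom} {t : Term} {A B : Ty Atom}
      (h₁ : AddTyping Γ t A) (h₂ : AddTyping Γ t B) : AddTyping Γ t (.inter A B)
  | interE₁ {Γ : Env Atom} {t : Term} {A B : Ty Atom}
      (h : AddTyping Γ t (.inter A B)) : AddTyping Γ t A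
  | interE₂ {Γ : Env Atom} {t : Term} {A B : Ty Atom}
      (h : AddTyping Γ t (.inter A B)) : AddTyping Γ t B

/-- Derivability `Γ ⊢ t : A` in the multiplicative intersection type system for `Λ`-terms. -/
inductive MulTyping {Atom : Type*} : Env Atom → Term → Ty Atom → Prop
  | ax (x : ℕ) (A : Ty Atom) : MulTyping (Env.single x A) (.var x) A
  | app {Γ Δ : Env Atom} {t u : Term} {A B : Ty Atom} (hc : Γ.Compatible Δ)
      (ht : MulTyping Γ t (.arrow A B)) (hu : MulTyping Δ u A) :
      MulTyping (Γ.union Δ) (.app t u) B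
  | abs₁ {Γ : Env Atom} {t : Term} {A B : Ty Atom}
      (ht : MulTyping (Γ.cons (some A)) t B) : MulTyping Γ (.lam t) (.arrow A B)
  | abs₂ {Γ : Env Atom} {t : Term} {A B : Ty Atom}
      (ht : MulTyping (Γ.cons none) t B) : MulTyping Γ (.lam t) (.arrow A B)
  | subs₁ {Γ Δ : Env Atom} {t u : Term} {A B : Ty Atom} (hc : Γ.Compatible Δ)
      (hu : MulTyping Γ u B) (ht : MulTyping (Δ.cons (some B)) t A) :
      MulTyping (Γ.union Δ) (.clos t u) A
  | subs₂ {Γ Δ : Env Atom} {t u : Term} {A B : Ty Atom} (hc : Γ.Compatible Δ)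
      (hu : MulTyping Γ u B) (ht : MulTyping (Δ.cons none) t A) :
      MulTyping (Γ.union Δ) (.clos t u) A
  | interI {Γ : Env Atom} {t : Term} {A B : Ty Atom}
      (h₁ : MulTyping Γ t A) (h₂ : MulTyping Γ t B) : MulTyping Γ t (.inter A B)
  | interE₁ {Γ : Env Atom} {t : Term} {A B : Ty Atom}
      (h : MulTyping Γ t (.inter A B)) : MulTyping Γ t A
  | interE₂ {Γ : Env Atom} {t : Term} {A B : Ty Atom}
      (h : MulTyping Γ t (.inter A B)) : MulTyping Γ t B

/-- `t` is typable in the additive intersection type system over the base types `Atom`. -/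
def AddTypable (Atom : Type*) (t : Term) : Prop :=
  ∃ (Γ : Env Atom) (A : Ty Atom), AddTyping Γ t A

/-- `t` is typable in the multiplicative intersection type system over the base types `Atom`. -/
def MulTypable (Atom : Type*) (t : Term) : Prop :=
  ∃ (Γ : Env Atom) (A : Ty Atom), MulTyping Γ t A

end LambdaSub

namespace LambdaSub

/-! ## Renaming and parallel substitution -/

/-! Induct along reduction, then on the size of subterms, and write the term as a head applied to
arguments. If the head is a variable, the arguments are typable by induction and the head may be
given any arrow type that fits. A lone abstraction is typed through its body. If the head is a redex
or a closure, it reduces in at least one step to the implicit substitution (`transGen_clos`), which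
is typable by induction, so subject expansion at the head suffices.

Expansion rests on `AddTyping.exists_of_subst`: the types that the copies of the argument receive
are collected into one intersection. An erased argument has no copies; its type comes from the
induction on subterms. Multiplicative typings follow by restricting environments to free variables.
-/

theorem liftRen_comp (ξ ζ : ℕ → ℕ) : liftRen ξ ∘ liftRen ζ = liftRen (ξ ∘ ζ) := by
  funext x
  cases x <;> rfl

theorem Term.rename_rename (t : Term) (ξ ζ : ℕ → ℕ) :
    (t.rename ζ).rename ξ = t.rename (ξ ∘ ζ) := by
  induction t generalizing ξ ζ with
  | var x => rfl
  | app t u iht ihu => simp only [Term.rename, iht, ihu]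
  | lam t ih => simp only [Term.rename, ih, liftRen_comp]
  | clos t u iht ihu => simp only [Term.rename, iht, ihu, liftRen_comp]

/-- The substitution that acts as `σ` below one more binder. -/
def liftSubst (σ : ℕ → Term) : ℕ → Term
  | 0 => .var 0
  | n + 1 => (σ n).rename Nat.succ

/-- Capture-avoiding parallel substitution. -/
def Term.subst : (ℕ → Term) → Term → Term
  | σ, .var x => σ x
  | σ, .app t u => .app (t.subst σ) (u.subst σ)
  | σ, .lam t => .lam (t.subst (liftSubst σ))
  | σ, .clos t u => .clos (t.subst (liftSubst σ)) (u.subst σ)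

theorem rename_liftSubst (σ : ℕ → Term) (ξ : ℕ → ℕ) :
    (fun x => (liftSubst σ x).rename (liftRen ξ)) = liftSubst (fun x => (σ x).rename ξ) := by
  funext x
  cases x with
  | zero => rfl
  | succ n =>
    simp only [liftSubst, Term.rename_rename]
    rfl

theorem Term.rename_subst (t : Term) (σ : ℕ → Term) (ξ : ℕ → ℕ) :
    (t.subst σ).rename ξ = t.subst (fun x => (σ x).rename ξ) := by
  induction t generalizing σ ξ with
  | var x => rfl
  | app t u iht ihu => simp only [Term.rename, Term.subst, iht, ihu]
  | lam t ih => simp only [Term.rename, Term.subst, ih, rename_liftSubst]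
  | clos t u iht ihu => simp only [Term.rename, Term.subst, iht, ihu, rename_liftSubst]

/-- The substitution of `u` for the index `0`, the other indices going down by one. -/
def instSubst (u : Term) : ℕ → Term
  | 0 => u
  | n + 1 => .var n

/-- The substitution, below `d` further binders, of `u` for the index `0` which leaves the other
indices in place. -/
def replaceSubst (u : Term) (d : ℕ) : ℕ → Term :=
  fun x => if x = d then (u.shift 1).shift d else .var x

theorem liftSubst_replaceSubst (u : Term) (d : ℕ) :
    liftSubst (replaceSubst u d) = replaceSubst u (d + 1) := by
  funext x
  cases x with
  | zero => simp [liftSubst, replaceSubst]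
  | succ n =>
    by_cases h : n = d
    · subst h
      simp only [liftSubst, replaceSubst, if_true, Term.shift, Term.rename_rename]
      rfl
    · simp [liftSubst, replaceSubst, h, Term.rename]

/-- Once every occurrence of the closure's variable is replaced, the body is literally a shift, the
form that `Gc` demands. -/
theorem shift_subst_instSubst (t u : Term) :
    (t.subst (instSubst u)).shift 1 = t.subst (replaceSubst u 0) := by
  rw [Term.shift, Term.rename_subst]
  congr 1
  funext x
  cases x with
  | zero =>
    simp only [instSubst, replaceSubst, if_true, Term.shift, Term.rename_rename]
    rfl
  | succ n => simp [instSubst, replaceSubst, Term.rename]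

/-! ## Contexts and reduction -/

/-- Composition of contexts: `C.comp D` is `C` with its hole replaced by `D`. -/
def Ctx.comp : Ctx → Ctx → Ctx
  | .hole, D => D
  | .appL C t, D => .appL (C.comp D) t
  | .appR t C, D => .appR t (C.comp D)
  | .lam C, D => .lam (C.comp D)
  | .closL C t, D => .closL (C.comp D) t
  | .closR t C, D => .closR t (C.comp D)

theorem Ctx.fill_comp (C D : Ctx) (s : Term) : (C.comp D).fill s = C.fill (D.fill s) := by
  induction C <;> simp_all [Ctx.comp, Ctx.fill]

theorem Ctx.depth_comp (C D : Ctx) : (C.comp D).depth = C.depth + D.depth := by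
  induction C <;> simp_all [Ctx.comp, Ctx.depth] <;> omega

theorem Red.fill {s s' : Term} (h : Red s s') (C : Ctx) : Red (C.fill s) (C.fill s') := by
  obtain ⟨D, h⟩ := h
  rw [← Ctx.fill_comp, ← Ctx.fill_comp]
  exact .ctx _ h

theorem Red.of_rule {s s' : Term} (h : Rule s s') : Red s s' := .ctx .hole h

open Relation in
theorem transGen_fill {s s' : Term} (h : TransGen Red s s') (C : Ctx) :
    TransGen Red (C.fill s) (C.fill s') :=
  h.lift C.fill fun _ _ h => h.fill C

open Relation in
/-- A closure may replace all occurrences of its variable in a part of its body. -/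
theorem reflTransGen_clos_fill (C : Ctx) (s u : Term) :
    ReflTransGen Red (.clos (C.fill s) u)
      (.clos (C.fill (s.subst (replaceSubst u C.depth))) u) := by
  induction s generalizing C with
  | var x =>
    by_cases h : x = C.depth
    · subst h
      have := Red.of_rule (Rule.R C u)
      simp only [Ctx.fillNoCapture, Term.shift, Term.rename, Nat.zero_add] at this
      simpa [Term.subst, replaceSubst, Term.shift] using ReflTransGen.single this
    · simp only [Term.subst, replaceSubst, h, if_false]
      exact .refl
  | app a b iha ihb =>
    have h₁ := iha (C.comp (.appL .hole b))
    -- The left subterm has already been rewritten, so it appears substituted in the context around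
    -- `b`.
    have h₂ := ihb (C.comp (.appR (a.subst (replaceSubst u C.depth)) .hole))
    simp only [Ctx.fill_comp, Ctx.depth_comp, Ctx.fill, Ctx.depth, Nat.add_zero] at h₁ h₂
    exact h₁.trans h₂
  | lam a ih =>
    have h₁ := ih (C.comp (.lam .hole))
    simp only [Ctx.fill_comp, Ctx.depth_comp, Ctx.fill, Ctx.depth, Nat.zero_add] at h₁
    simpa only [Term.subst, liftSubst_replaceSubst] using h₁
  | clos a b iha ihb =>
    have h₁ := iha (C.comp (.closL .hole b))
    have h₂ := ihb (C.comp (.closR (a.subst (replaceSubst u (C.depth + 1))) .hole))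
    simp only [Ctx.fill_comp, Ctx.depth_comp, Ctx.fill, Ctx.depth, Nat.add_zero,
      Nat.zero_add] at h₁ h₂
    simpa only [Term.subst, liftSubst_replaceSubst] using h₁.trans h₂

open Relation in
/-- Full composition: a closure reduces to the implicit substitution. -/
theorem transGen_clos (t u : Term) : TransGen Red (.clos t u) (t.subst (instSubst u)) := by
  have h := reflTransGen_clos_fill .hole t u
  simp only [Ctx.fill, Ctx.depth, ← shift_subst_instSubst] at h
  exact TransGen.tail' h (.of_rule (.Gc _ _))

open Relation in
theorem transGen_beta (t u : Term) :
    TransGen Red (.app (.lam t) u) (t.subst (instSubst u)) :=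
  TransGen.head (.of_rule (.B t u)) (transGen_clos t u)

theorem SN.acc {t : Term} (h : SN t) : Acc (flip Red) t := by
  by_contra hacc
  obtain ⟨f, h₀, hf⟩ := not_acc_iff_exists_descending_chain.mp hacc
  exact h ⟨f, h₀, hf⟩

/-! ## The additive system -/

section Additive

variable {Atom : Type*} {Γ Δ : Env Atom} {t u s s' : Term} {A B : Ty Atom}

theorem Env.cons_comp_liftRen (Γ : Env Atom) (o : Option (Ty Atom)) (ξ : ℕ → ℕ) :
    Γ.cons o ∘ liftRen ξ = Env.cons (Γ ∘ ξ) o := by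
  funext x
  cases x <;> rfl

theorem AddTyping.of_rename {ξ : ℕ → ℕ} (h : AddTyping Γ (t.rename ξ) A) :
    AddTyping (Γ ∘ ξ) t A := by
  generalize hr : t.rename ξ = r at h
  induction h generalizing t ξ with
  | ax h =>
    cases t <;> simp only [Term.rename, Term.var.injEq, reduceCtorEq] at hr
    subst hr
    exact .ax h
  | app _ _ iht ihu =>
    cases t <;> simp only [Term.rename, Term.app.injEq, reduceCtorEq] at hr
    exact .app (iht hr.1) (ihu hr.2)
  | abs _ ih =>
    cases t <;> simp only [Term.rename, Term.lam.injEq, reduceCtorEq] at hr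
    exact .abs (Env.cons_comp_liftRen _ _ _ ▸ ih hr)
  | subs _ _ ihu iht =>
    cases t <;> simp only [Term.rename, Term.clos.injEq, reduceCtorEq] at hr
    exact .subs (ihu hr.2) (Env.cons_comp_liftRen _ _ _ ▸ iht hr.1)
  | interI _ _ ih₁ ih₂ => exact .interI (ih₁ hr) (ih₂ hr)
  | interE₁ _ ih => exact .interE₁ (ih hr)
  | interE₂ _ ih => exact .interE₂ (ih hr)

/-- The types of a variable depend on its declaration only. -/
theorem AddTyping.var_congr {x y : ℕ} (h : AddTyping Γ (.var x) A) (hxy : Δ y = Γ x) :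
    AddTyping Δ (.var y) A := by
  generalize hr : Term.var x = r at h
  induction h with
  | ax h =>
    cases hr
    exact .ax (hxy.trans h)
  | interI _ _ ih₁ ih₂ => exact .interI (ih₁ hxy hr) (ih₂ hxy hr)
  | interE₁ _ ih => exact .interE₁ (ih hxy hr)
  | interE₂ _ ih => exact .interE₂ (ih hxy hr)
  | _ => cases hr

/-- Old declarations need only be derivable in `Δ`, not declared there, so a declaration may be
strengthened to an intersection. -/
theorem AddTyping.mono (h : AddTyping Γ t A)
    (hΔ : ∀ x B, Γ x = some B → AddTyping Δ (.var x) B) : AddTyping Δ t A := by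
  have lift : ∀ {Γ Δ : Env Atom} (o : Option (Ty Atom)),
      (∀ x B, Γ x = some B → AddTyping Δ (.var x) B) →
      ∀ x B, Γ.cons o x = some B → AddTyping (Δ.cons o) (.var x) B := by
    intro Γ Δ o h x B hx
    cases x with
    | zero => exact .ax hx
    | succ n => exact (h n B hx).var_congr rfl
  induction h generalizing Δ with
  | ax h => exact hΔ _ _ h
  | app _ _ iht ihu => exact .app (iht hΔ) (ihu hΔ)
  | abs _ ih => exact .abs (ih (lift _ hΔ))
  | subs _ _ ihu iht => exact .subs (ihu hΔ) (iht (lift _ hΔ))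
  | interI _ _ ih₁ ih₂ => exact .interI (ih₁ hΔ) (ih₂ hΔ)
  | interE₁ _ ih => exact .interE₁ (ih hΔ)
  | interE₂ _ ih => exact .interE₂ (ih hΔ)

/-- The environment that assigns to a variable the intersection of its types. -/
def Env.meet (Γ Δ : Env Atom) : Env Atom := fun x =>
  match Γ x, Δ x with
  | some A, some B => some (.inter A B)
  | some A, none => some A
  | none, o => o

theorem AddTyping.meet_left (h : AddTyping Γ t A) (Δ : Env Atom) : AddTyping (Γ.meet Δ) t A := by
  refine h.mono fun x B hx => ?_
  cases hΔ : Δ x with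
  | none => exact .ax (by simp [Env.meet, hx, hΔ])
  | some C => exact .interE₁ (.ax (by simp only [Env.meet, hx, hΔ]; rfl))

theorem AddTyping.meet_right (h : AddTyping Δ t A) (Γ : Env Atom) : AddTyping (Γ.meet Δ) t A := by
  refine h.mono fun x B hx => ?_
  cases hΓ : Γ x with
  | none => exact .ax (by simp [Env.meet, hx, hΓ])
  | some C => exact .interE₂ (.ax (by simp only [Env.meet, hx, hΓ]; rfl))

/-- `σ` maps the variables declared in `Δ` to terms which have the declared types in `Γ`. -/
def SubstTyping (Γ : Env Atom) (σ : ℕ → Term) (Δ : Env Atom) : Prop :=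
  ∀ x B, Δ x = some B → AddTyping Γ (σ x) B

theorem SubstTyping.meet {σ : ℕ → Term} {Δ₁ Δ₂ : Env Atom} (h₁ : SubstTyping Γ σ Δ₁)
    (h₂ : SubstTyping Γ σ Δ₂) : SubstTyping Γ σ (Δ₁.meet Δ₂) := by
  intro x B hx
  rcases e₁ : Δ₁ x with _ | C <;> rcases e₂ : Δ₂ x with _ | D <;>
    simp only [Env.meet, e₁, e₂, Option.some.injEq, reduceCtorEq] at hx <;> subst hx
  · exact h₂ x _ e₂
  · exact h₁ x _ e₁
  · exact .interI (h₁ x _ e₁) (h₂ x _ e₂)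

/-- A lifted substitution fixes index `0`, so its type in `Δ` is derivable from `A` and `A` can
replace it; for the other indices the shift is stripped by `AddTyping.of_rename`. -/
theorem SubstTyping.exists_of_liftSubst {σ : ℕ → Term}
    (h : SubstTyping (Γ.cons (some A)) (liftSubst σ) Δ) (ht : AddTyping Δ t B) :
    ∃ Δ', SubstTyping Γ σ Δ' ∧ AddTyping (Δ'.cons (some A)) t B := by
  refine ⟨fun n => Δ (n + 1), fun x C hx => (h (x + 1) C hx).of_rename, ht.mono fun x C hx => ?_⟩
  cases x with
  | zero => exact (h 0 C hx).var_congr rfl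
  | succ n => exact .ax hx

/-- A typing of a substitution instance comes from a typing of the term. -/
theorem AddTyping.exists_of_subst {σ : ℕ → Term} (h : AddTyping Γ (t.subst σ) A) :
    ∃ Δ, SubstTyping Γ σ Δ ∧ AddTyping Δ t A := by
  -- If the term is a variable, the derivation is kept whole as a typing of its image, whatever its
  -- last rule.
  have var : ∀ {Γ : Env Atom} {σ : ℕ → Term} {x : ℕ} {A : Ty Atom}, AddTyping Γ (σ x) A →
      ∃ Δ, SubstTyping Γ σ Δ ∧ AddTyping Δ (.var x) A := by
    intro Γ σ x A h
    refine ⟨Env.single x A, fun y B hy => ?_, .ax (by simp [Env.single])⟩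
    simp only [Env.single, Option.ite_none_right_eq_some, Option.some.injEq] at hy
    obtain ⟨rfl, rfl⟩ := hy
    exact h
  generalize hr : t.subst σ = r at h
  induction h generalizing t σ with
  | ax h =>
    cases t <;> simp only [Term.subst, reduceCtorEq] at hr
    exact var (hr ▸ .ax h)
  | app ht hu iht ihu =>
    cases t <;> simp only [Term.subst, Term.app.injEq, reduceCtorEq] at hr
    · exact var (hr ▸ .app ht hu)
    · obtain ⟨Δ₁, h₁, h₁'⟩ := iht hr.1
      obtain ⟨Δ₂, h₂, h₂'⟩ := ihu hr.2
      exact ⟨_, h₁.meet h₂, .app (h₁'.meet_left _) (h₂'.meet_right _)⟩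
  | abs ht ih =>
    cases t <;> simp only [Term.subst, Term.lam.injEq, reduceCtorEq] at hr
    · exact var (hr ▸ .abs ht)
    · obtain ⟨Δ, h, h'⟩ := ih hr
      obtain ⟨Δ', h, h'⟩ := h.exists_of_liftSubst h'
      exact ⟨Δ', h, .abs h'⟩
  | subs hu ht ihu iht =>
    cases t <;> simp only [Term.subst, Term.clos.injEq, reduceCtorEq] at hr
    · exact var (hr ▸ .subs hu ht)
    · obtain ⟨Δ₁, h₁, h₁'⟩ := ihu hr.2
      obtain ⟨Δ, h, h'⟩ := iht hr.1
      obtain ⟨Δ₂, h₂, h₂'⟩ := h.exists_of_liftSubst h'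
      refine ⟨_, h₁.meet h₂, .subs (h₁'.meet_left _) (h₂'.mono fun x C hx => ?_)⟩
      cases x with
      | zero => exact .ax hx
      | succ n => exact ((AddTyping.ax (x := n) hx).meet_right Δ₁).var_congr rfl
  | interI _ _ ih₁ ih₂ =>
    obtain ⟨Δ₁, h₁, h₁'⟩ := ih₁ hr
    obtain ⟨Δ₂, h₂, h₂'⟩ := ih₂ hr
    exact ⟨_, h₁.meet h₂, .interI (h₁'.meet_left _) (h₂'.meet_right _)⟩
  | interE₁ _ ih =>
    obtain ⟨Δ, h, h'⟩ := ih hr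
    exact ⟨Δ, h, .interE₁ h'⟩
  | interE₂ _ ih =>
    obtain ⟨Δ, h, h'⟩ := ih hr
    exact ⟨Δ, h, .interE₂ h'⟩

theorem AddTyping.exists_of_subst_instSubst (h : AddTyping Γ (t.subst (instSubst u)) A)
    (hu : AddTyping Γ u B) :
    ∃ C, AddTyping Γ u C ∧ AddTyping (Γ.cons (some C)) t A := by
  obtain ⟨Δ, hΔ, ht⟩ := h.exists_of_subst
  have key : ∀ C, (∀ D, Δ 0 = some D → D = C) → AddTyping (Γ.cons (some C)) t A := by
    refine fun C hC => ht.mono fun x D hx => ?_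
    cases x with
    | zero => exact .ax (by rw [hC D hx]; rfl)
    | succ n => exact (hΔ (n + 1) D hx).var_congr rfl
  -- With no declaration of index `0`, nothing is known about `u` from `h`; this is where the
  -- separate typing `hu` is needed.
  cases h₀ : Δ 0 with
  | none => exact ⟨B, hu, key B (by simp [h₀])⟩
  | some C => exact ⟨C, hΔ 0 C h₀, key C (by simp [h₀])⟩

/-- Subject expansion for a closure. -/
theorem AddTyping.clos_of_subst (h : AddTyping Γ (t.subst (instSubst u)) A)
    (hu : AddTyping Γ u B) : AddTyping Γ (.clos t u) A :=
  have ⟨_, hu, ht⟩ := h.exists_of_subst_instSubst hu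
  .subs hu ht

/-- Subject expansion for a `β`-redex. -/
theorem AddTyping.beta_of_subst (h : AddTyping Γ (t.subst (instSubst u)) A)
    (hu : AddTyping Γ u B) : AddTyping Γ (.app (.lam t) u) A :=
  have ⟨_, hu, ht⟩ := h.exists_of_subst_instSubst hu
  .app (.abs ht) hu

/-- The derivation may end with intersection rules, hence the induction down to the application
rules. -/
theorem AddTyping.app_congr (hs : ∀ B, AddTyping Γ s B → AddTyping Γ s' B)
    (h : AddTyping Γ (.app s u) A) : AddTyping Γ (.app s' u) A := by
  generalize hr : Term.app s u = r at h
  induction h with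
  | app ht hu =>
    cases hr
    exact .app (hs _ ht) hu
  | interI _ _ ih₁ ih₂ => exact .interI (ih₁ hs hr) (ih₂ hs hr)
  | interE₁ _ ih => exact .interE₁ (ih hs hr)
  | interE₂ _ ih => exact .interE₂ (ih hs hr)
  | _ => cases hr

end Additive

/-! ## Iterated application -/

/-- The application of a term to a list of arguments. -/
def Term.apps (s : Term) (l : List Term) : Term := l.foldl .app s

/-- The context that applies its hole to a list of arguments. -/
def Ctx.apps (C : Ctx) (l : List Term) : Ctx := l.foldl .appL C

theorem Ctx.fill_apps (C : Ctx) (l : List Term) (s : Term) :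
    (C.apps l).fill s = (C.fill s).apps l := by
  induction l generalizing C with
  | nil => rfl
  | cons a l ih => exact ih (.appL C a)

theorem Term.exists_eq_apps (t : Term) :
    ∃ (s : Term) (l : List Term), t = s.apps l ∧ ∀ a b, s ≠ .app a b := by
  induction t with
  | app t u ih _ =>
    obtain ⟨s, l, rfl, hs⟩ := ih
    exact ⟨s, l ++ [u], by simp [Term.apps], hs⟩
  | _ => exact ⟨_, [], rfl, by simp⟩

theorem Ctx.exists_fill_eq_apps {p : Term} {l : List Term} (s : Term) (hp : p ∈ l) :
    ∃ C : Ctx, C.fill p = s.apps l ∧ C ≠ .hole := by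
  obtain ⟨l₁, l₂, rfl⟩ := List.append_of_mem hp
  refine ⟨Ctx.apps (.appR (s.apps l₁) .hole) l₂, ?_, ?_⟩
  · rw [Ctx.fill_apps]
    simp [Term.apps, Ctx.fill]
  · have : ∀ (l : List Term) (C : Ctx), C ≠ .hole → C.apps l ≠ .hole := by
      intro l
      induction l with
      | nil => exact fun _ h => h
      | cons a l ih => exact fun C _ => ih (.appL C a) (by simp)
    exact this _ _ (by simp)

/-! ### Typability of strongly normalising terms -/

section Typability

variable {Atom : Type*} {Γ : Env Atom} {s s' : Term} {A : Ty Atom}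

theorem AddTyping.apps_congr (hs : ∀ B, AddTyping Γ s B → AddTyping Γ s' B) (l : List Term)
    (h : AddTyping Γ (s.apps l) A) : AddTyping Γ (s'.apps l) A := by
  induction l generalizing s s' with
  | nil => exact hs _ h
  | cons a l ih => exact ih (fun _ => AddTyping.app_congr hs) h

/-- Since the head can receive every type, it can receive an arrow from whatever type the next
argument has; the resulting application again receives every type. -/
theorem exists_addTyping_apps (l : List Term) (hl : ∀ p ∈ l, AddTypable Atom p)
    (hs : ∀ A : Ty Atom, ∃ Γ, AddTyping Γ s A) (A : Ty Atom) :
    ∃ Γ, AddTyping Γ (s.apps l) A := by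
  induction l generalizing s with
  | nil => exact hs A
  | cons a l ih =>
    refine ih (s := s.app a) (fun p hp => hl p (List.mem_cons_of_mem _ hp)) fun B => ?_
    obtain ⟨Γ₁, C, ha⟩ := hl a List.mem_cons_self
    obtain ⟨Γ₂, hs⟩ := hs (.arrow C B)
    exact ⟨Γ₂.meet Γ₁, .app (hs.meet_left _) (ha.meet_right _)⟩

theorem AddTypable.apps_of_expansion {t u : Term} {l : List Term}
    (h : AddTypable Atom ((t.subst (instSubst u)).apps l)) (hu : AddTypable Atom u)
    (hs : ∀ (Γ : Env Atom) (A B : Ty Atom), AddTyping Γ (t.subst (instSubst u)) A →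
      AddTyping Γ u B → AddTyping Γ s A) : AddTypable Atom (s.apps l) := by
  obtain ⟨Γ, A, h⟩ := h
  obtain ⟨Δ, B, hu⟩ := hu
  exact ⟨Γ.meet Δ, A, AddTyping.apps_congr
    (fun C hC => hs _ C B hC (hu.meet_right _)) l (h.meet_left _)⟩

theorem AddTypable.lam {t : Term} (h : AddTypable Atom t) : AddTypable Atom (.lam t) := by
  obtain ⟨Γ, A, h⟩ := h
  cases h₀ : Γ 0 with
  | none =>
    -- The domain type is arbitrary here; `A` is merely at hand.
    refine ⟨fun n => Γ (n + 1), .arrow A A, .abs (h.mono fun x B hx => ?_)⟩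
    cases x with
    | zero => simp [h₀] at hx
    | succ n => exact .ax hx
  | some C =>
    refine ⟨fun n => Γ (n + 1), .arrow C A, .abs (h.mono fun x B hx => ?_)⟩
    cases x with
    | zero => exact .ax (h₀.symm.trans hx)
    | succ n => exact .ax hx

theorem Ctx.sizeOf_lt {C : Ctx} (h : C ≠ .hole) (p : Term) : sizeOf p < sizeOf (C.fill p) := by
  induction C with
  | hole => exact absurd rfl h
  | appL C t ih | appR t C ih | lam C ih | closL C t ih | closR t C ih =>
    by_cases hC : C = .hole
    · subst hC
      simp [Ctx.fill]
      try omega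
    · have := ih hC
      simp [Ctx.fill]
      omega

open Relation in
/-- The induction step for the typability of strongly normalising terms. -/
theorem addTypable_of_reducts_of_subterms [Nonempty Atom] {t : Term}
    (hred : ∀ t', TransGen Red t t' → AddTypable Atom t')
    (hsub : ∀ (C : Ctx) (p : Term), C ≠ .hole → C.fill p = t → AddTypable Atom p) :
    AddTypable Atom t := by
  obtain ⟨s, l, rfl, hs⟩ := t.exists_eq_apps
  have hl : ∀ p ∈ l, AddTypable Atom p := fun p hp =>
    have ⟨C, hC, hne⟩ := Ctx.exists_fill_eq_apps s hp
    hsub C p hne hC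
  have hexp : ∀ {s : Term} {l : List Term} {s' : Term}, TransGen Red s s' →
      TransGen Red (s.apps l) (s'.apps l) := by
    intro s l s' h
    simpa [Ctx.fill_apps, Ctx.fill] using transGen_fill h (Ctx.apps .hole l)
  cases s with
  | var x =>
    obtain ⟨a⟩ := ‹Nonempty Atom›
    obtain ⟨Γ, h⟩ := exists_addTyping_apps (s := .var x) l hl
      (fun A => ⟨Env.single x A, .ax (by simp [Env.single])⟩) (.base a)
    exact ⟨Γ, _, h⟩
  | app a b => exact absurd rfl (hs a b)
  | lam a =>
    cases l with
    | nil => exact (hsub (.lam .hole) a (by simp) rfl).lam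
    | cons b l =>
      exact AddTypable.apps_of_expansion (s := .app (.lam a) b)
        (hred _ (hexp (transGen_beta a b))) (hl b List.mem_cons_self)
        fun _ _ _ h hu => h.beta_of_subst hu
  | clos a b =>
    refine AddTypable.apps_of_expansion (hred _ (hexp (transGen_clos a b)))
      (hsub (Ctx.apps (.closR a .hole) l) b ?_ ?_) fun _ _ _ h hu => h.clos_of_subst hu
    -- Were the context the hole, filling it with a variable would make that variable a closure or
    -- an application.
    · intro h
      have := congrArg (fun C => Ctx.fill C (.var 0)) h
      simp only [Ctx.fill_apps, Ctx.fill] at this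
      rcases l.eq_nil_or_concat with rfl | ⟨l, c, rfl⟩ <;> simp [Term.apps] at this
    · simp [Ctx.fill_apps, Ctx.fill]

open Relation in
theorem SN.addTypable [Nonempty Atom] {t : Term} (ht : SN t) : AddTypable Atom t := by
  -- Generalising to all subterms of `t` lets a reduct of a subterm count as a reduct of `t`.
  -- Transitive closure is needed because one head contraction takes several steps.
  suffices h : ∀ (C : Ctx) (p : Term), C.fill p = t → AddTypable Atom p from h .hole t rfl
  have hacc := ht.acc.transGen
  clear ht
  induction hacc with
  | intro t _ ih =>
    intro C p
    induction hn : sizeOf p using Nat.strong_induction_on generalizing C p with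
    | _ n ihn =>
      subst hn
      rintro rfl
      refine addTypable_of_reducts_of_subterms (fun p' hp => ?_) fun D q hD hq => ?_
      · exact ih (C.fill p') (transGen_swap.mpr (transGen_fill hp C)) C p' rfl
      · subst hq
        exact ihn _ (Ctx.sizeOf_lt hD q) (C.comp D) q rfl (Ctx.fill_comp C D q)

end Typability

/-! ## From the additive to the multiplicative system -/

/-- `x` is a free variable of the term. -/
def Term.IsFree : ℕ → Term → Prop
  | x, .var y => x = y
  | x, .app t u => t.IsFree x ∨ u.IsFree x
  | x, .lam t => t.IsFree (x + 1)
  | x, .clos t u => u.IsFree x ∨ t.IsFree (x + 1)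

open Classical in
/-- The restriction of an environment to the free variables of a term. -/
noncomputable def Env.restrict {Atom : Type*} (Γ : Env Atom) (t : Term) : Env Atom :=
  fun x => if t.IsFree x then Γ x else none

section Multiplicative

variable {Atom : Type*} {Γ : Env Atom} {t : Term} {A : Ty Atom}

/-- Restrictions of one environment always agree, so unions are compatible. The restriction depends
only on the term, so both premises of `interI` get the same environment. -/
theorem AddTyping.mulTyping (h : AddTyping Γ t A) : MulTyping (Γ.restrict t) t A := by
  have compat : ∀ {Γ Δ Θ : Env Atom}, (∀ x B, Γ x = some B → Θ x = some B) →
      (∀ x B, Δ x = some B → Θ x = some B) → Γ.Compatible Δ :=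
    fun h₁ h₂ x A B hA hB => Option.some.inj ((h₁ x A hA).symm.trans (h₂ x B hB))
  have le : ∀ (Γ : Env Atom) (t : Term) x B, Γ.restrict t x = some B → Γ x = some B := by
    intro Γ t x B h
    simp only [Env.restrict, Option.ite_none_right_eq_some] at h
    exact h.2
  -- Whether the bound variable occurs decides between the two variants of the abstraction and
  -- closure rules.
  have split : ∀ (Γ : Env Atom) (C : Ty Atom) (t : Term),
      (Γ.cons (some C)).restrict t = Env.cons (Γ.restrict (.lam t)) (some C) ∨
      (Γ.cons (some C)).restrict t = Env.cons (Γ.restrict (.lam t)) none := by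
    intro Γ C t
    by_cases h₀ : t.IsFree 0
    · refine .inl (funext fun x => ?_)
      cases x with
      | zero => simp [Env.restrict, Env.cons, h₀]
      | succ n => rfl
    · refine .inr (funext fun x => ?_)
      cases x with
      | zero => simp [Env.restrict, Env.cons, h₀]
      | succ n => rfl
  have union : ∀ (Γ : Env Atom) (r t u : Term), (∀ x, r.IsFree x ↔ t.IsFree x ∨ u.IsFree x) →
      Γ.restrict r = (Γ.restrict t).union (Γ.restrict u) := by
    intro Γ r t u hr
    funext x
    by_cases h₁ : t.IsFree x <;> by_cases h₂ : u.IsFree x <;>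
      simp [Env.restrict, Env.union, hr, h₁, h₂]
  induction h with
  | @ax Γ x A h =>
    have : Γ.restrict (.var x) = Env.single x A := by
      funext y
      by_cases hy : y = x
      · subst hy
        simp [Env.restrict, Env.single, Term.IsFree, h]
      · simp [Env.restrict, Env.single, Term.IsFree, hy]
    exact this ▸ .ax x A
  | @app Γ t u _ _ _ _ iht ihu =>
    rw [union Γ (.app t u) t u fun _ => Iff.rfl]
    exact .app (compat (le Γ t) (le Γ u)) iht ihu
  | @abs Γ t A _ _ ih =>
    rcases split Γ A t with h | h <;> rw [h] at ih
    · exact .abs₁ ih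
    · exact .abs₂ ih
  | @subs Γ t u _ B _ _ ihu iht =>
    -- Outside its binder, the body of a closure has the free variables of `.lam t`.
    rw [union Γ (.clos t u) u (.lam t) fun _ => Iff.rfl]
    rcases split Γ B t with h | h <;> rw [h] at iht
    · exact .subs₁ (compat (le Γ u) (le Γ (.lam t))) ihu iht
    · exact .subs₂ (compat (le Γ u) (le Γ (.lam t))) ihu iht
  | interI _ _ ih₁ ih₂ => exact .interI ih₁ ih₂
  | interE₁ _ ih => exact .interE₁ ih
  | interE₂ _ ih => exact .interE₂ ih

end Multiplicative

theorem AddTypable.mulTypable {Atom : Type*} {t : Term} (h : AddTypable Atom t) :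
    MulTypable Atom t :=
  have ⟨_, A, h⟩ := h
  ⟨_, A, h.mulTyping⟩

end LambdaSub

theorem theoremt (Atom : Type*) [Countable Atom] [Nonempty Atom] (t : LambdaSub.Term)
    (ht : LambdaSub.SN t) :
    LambdaSub.AddTypable Atom t ∧ LambdaSub.MulTypable Atom t :=
  ⟨ht.addTypable, ht.addTypable.mulTypable⟩
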